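/- Let $(\Omega,\mathcal F,\mathbb P)$ be a probability space and $d\ge 1$ an integer. Let $L^p_d$ ($p\in\{1,\infty\}$) be the space of $\mathbb R^d$-valued random vectors that are integrable ($p=1$), respectively essentially bounded ($p=\infty$), modulo almost sure equality, and put $L^\infty=L^\infty_1$. Inequalities between vectors are componentwise, and those between random variables or vectors hold almost surely. An *aggregation function* is a function $\Lambda:\mathbb R^d\to\mathbb R$ that is increasing ($x\le z\Rightarrow\Lambda(x)\le\Lambda(z)$), concave and non-constant; then $\Lambda(X)\in L^\infty$ for every $X\in L^\infty_d$. A *convex monetary risk measure* is a function $\rho:L^\infty\to\mathbb R$ such that, for all $Y,Y_1,Y_2\in L^\infty$, $y\in\mathbb R$, $\gamma\in[0,1]$: $Y_1\ge Y_2$ implies $\rho(Y_1)\le\rho(Y_2)$; $\rho(Y+y)=\rho(Y)-y$; $\rho(\gamma Y_1+(1-\gamma)Y_2)\le\gamma\rho(Y_1)+(1-\gamma)\rho(Y_2)$; and $\rho(Y)\le\liminf_n\rho(Y_n)$ whenever $(Y_n)_{n\ge1}$ is a bounded sequence in $L^\infty$ converging almost surely to $Y$. Its acceptance set is $\mathcal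 A=\{Y\in L^\infty\mid\rho(Y)\le0\}$. For such $\Lambda$ and $\rho$ define, for $X\in L^\infty_d$, $$R^{\mathrm{ins}}(X)=\Big\{z\in\mathbb R^d\;\Big|\;\Lambda(X)+\sum_{i=1}^d z_i\in\mathcal A\Big\},\qquad R^{\mathrm{sen}}(X)=\{z\in\mathbb R^d\mid\Lambda(X+z)\in\mathcal A\}.$$ For a set-valued function $R:L^\infty_d\to2^{\mathbb R^d}$ consider the following properties. (i) Monotonicity: $X\ge Z$ implies $R(X)\supseteq R(Z)$, for all $X,Z\in L^\infty_d$. (ii) Convexity: $R(\gamma X+(1-\gamma)Z)\supseteq\gamma R(X)+(1-\gamma)R(Z)$ for all $X,Z\in L^\infty_d$ and $\gamma\in[0,1]$. (iii) Closedness: for every $z\in\mathbb R^d$ the set $\{X\in L^\infty_d\mid z\in R(X)\}$ is closed in the weak$^*$ topology $\sigma(L^\infty_d,L^1_d)$. (iv) Finiteness at zero: $R(0)\notin\{\emptyset,\mathbb R^d\}$. (v) Translativity: $R(X+z)=R(X)-z$ for all $X\in L^\infty_d$ and $z\in\mathbb R^d$. **Proposition 2.5.** For every aggregation function $\Lambda$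 and every convex monetary risk measure $\rho$ with $\rho(0)\in\operatorname{int}\Lambda(\mathbb R^d)$: 1. $R^{\mathrm{ins}}$ satisfies (i)–(iv); 2. $R^{\mathrm{sen}}$ satisfies (i)–(v). Moreover, $R^{\mathrm{ins}}$ is not translative in general: for every probability space and every $d\ge1$ there are $\Lambda$ and $\rho$ as above, with $\rho(0)\in\operatorname{int}\Lambda(\mathbb R^d)$, for which $R^{\mathrm{ins}}$ does not satisfy (v). -/

import Mathlib

open MeasureTheory Filter Topology
open scoped ENNReal Pointwise

namespace SystemicRisk

/-- An aggregation function on `ℝ^d`: increasing for the componentwise order, concave and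
non-constant. -/
structure AggregationFunction (d : ℕ) where
  toFun : (Fin d → ℝ) → ℝ
  increasing : ∀ x z : Fin d → ℝ, x ≤ z → toFun x ≤ toFun z
  concave : ∀ (x z : Fin d → ℝ) (γ : ℝ), 0 ≤ γ → γ ≤ 1 →
    γ * toFun x + (1 - γ) * toFun z ≤ toFun (γ • x + (1 - γ) • z)
  nonconstant : ∃ x z : Fin d → ℝ, toFun x ≠ toFun z

instance (d : ℕ) : CoeFun (AggregationFunction d) (fun _ => (Fin d → ℝ) → ℝ) :=
  ⟨AggregationFunction.toFun⟩

theorem AggregationFunction.continuous {d : ℕ} (Λ : AggregationFunction d) :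
    Continuous Λ.toFun := by
  have h : ConcaveOn ℝ Set.univ Λ.toFun := by
    refine ⟨convex_univ, fun x _ z _ a b ha hb hab => ?_⟩
    obtain rfl : b = 1 - a := by linarith
    exact Λ.concave x z a ha (by linarith)
  exact continuousOn_univ.mp (h.continuousOn isOpen_univ)

variable {Ω : Type*} [MeasurableSpace Ω]

/-- `Λ(X)` is essentially bounded when `X` is. -/
theorem AggregationFunction.memLp {d : ℕ} (Λ : AggregationFunction d) {P : Measure Ω}
    (X : Lp (Fin d → ℝ) ∞ P) : MemLp (fun ω => Λ (X ω)) ∞ P := by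
  refine memLp_top_of_bound (Λ.continuous.comp_aestronglyMeasurable (Lp.aestronglyMeasurable X))
    (max |Λ (fun _ => ‖X‖)| |Λ (fun _ => -‖X‖)|) ?_
  filter_upwards [enorm_ae_le_eLpNormEssSup (X : Ω → Fin d → ℝ) P] with ω hω'
  have hω : ‖X ω‖ ≤ ‖X‖ := by
    rw [Lp.norm_def, ← toReal_enorm, eLpNorm_exponent_top]
    exact ENNReal.toReal_mono (by simpa using Lp.eLpNorm_ne_top X) hω'
  have hi : ∀ i, |X ω i| ≤ ‖X‖ := fun i => (norm_le_pi_norm (X ω) i).trans hω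
  have h1 : Λ (X ω) ≤ Λ (fun _ => ‖X‖) := Λ.increasing _ _ fun i => (abs_le.mp (hi i)).2
  have h2 : Λ (fun _ => -‖X‖) ≤ Λ (X ω) := Λ.increasing _ _ fun i => (abs_le.mp (hi i)).1
  rw [Real.norm_eq_abs]
  exact abs_le_max_abs_abs h2 h1 |>.trans (le_of_eq (max_comm _ _))

/-- The aggregate value `Λ(X) ∈ L^∞` of a random vector `X ∈ L_d^∞`. -/
noncomputable def aggregate {d : ℕ} (Λ : AggregationFunction d) {P : Measure Ω}
    (X : Lp (Fin d → ℝ) ∞ P) : Lp ℝ ∞ P :=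
  (Λ.memLp X).toLp (fun ω => Λ (X ω))

/-- A convex monetary risk measure on `L^∞` with the Fatou property. Constants are embedded in
`L^∞` by `Lp.const`. In the Fatou property the sequence `ρ (Y n)` is bounded, by monotonicity and
translativity, so that the `liminf` is the genuine one. -/
structure ConvexMonetaryRiskMeasure (P : Measure Ω) [IsProbabilityMeasure P] where
  toFun : Lp ℝ ∞ P → ℝ
  monotone : ∀ Y₁ Y₂ : Lp ℝ ∞ P, Y₂ ≤ Y₁ → toFun Y₁ ≤ toFun Y₂
  translative : ∀ (Y : Lp ℝ ∞ P) (y : ℝ), toFun (Y + Lp.const ∞ P y) = toFun Y - y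
  convex : ∀ (Y₁ Y₂ : Lp ℝ ∞ P) (γ : ℝ), 0 ≤ γ → γ ≤ 1 →
    toFun (γ • Y₁ + (1 - γ) • Y₂) ≤ γ * toFun Y₁ + (1 - γ) * toFun Y₂
  fatou : ∀ (Y : ℕ → Lp ℝ ∞ P) (Y₀ : Lp ℝ ∞ P), (∃ C : ℝ, ∀ n, ‖Y n‖ ≤ C) →
    (∀ᵐ ω ∂P, Tendsto (fun n => Y n ω) atTop (𝓝 (Y₀ ω))) →
    toFun Y₀ ≤ liminf (fun n => toFun (Y n)) atTop

instance (P : Measure Ω) [IsProbabilityMeasure P] :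
    CoeFun (ConvexMonetaryRiskMeasure P) (fun _ => Lp ℝ ∞ P → ℝ) :=
  ⟨ConvexMonetaryRiskMeasure.toFun⟩

section

variable {P : Measure Ω} [IsProbabilityMeasure P] {d : ℕ}

/-- The acceptance set of a risk measure. -/
def acceptanceSet (ρ : ConvexMonetaryRiskMeasure P) : Set (Lp ℝ ∞ P) :=
  {Y | ρ Y ≤ 0}

/-- The insensitive systemic risk measure. -/
def Rins (Λ : AggregationFunction d) (ρ : ConvexMonetaryRiskMeasure P)
    (X : Lp (Fin d → ℝ) ∞ P) : Set (Fin d → ℝ) :=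
  {z | aggregate Λ X + Lp.const ∞ P (∑ i, z i) ∈ acceptanceSet ρ}

/-- The sensitive systemic risk measure. -/
def Rsen (Λ : AggregationFunction d) (ρ : ConvexMonetaryRiskMeasure P)
    (X : Lp (Fin d → ℝ) ∞ P) : Set (Fin d → ℝ) :=
  {z | aggregate Λ (X + Lp.const ∞ P z) ∈ acceptanceSet ρ}

/-- The weak* topology `σ(L_d^∞, L_d^1)`: the coarsest topology on `L_d^∞` for which
`X ↦ E[U · X]` is continuous for every `U ∈ L_d^1`. -/
@[reducible]
noncomputable def weakStarTopology (d : ℕ) (P : Measure Ω) :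
    TopologicalSpace (Lp (Fin d → ℝ) ∞ P) :=
  ⨅ U : Lp (Fin d → ℝ) 1 P,
    TopologicalSpace.induced (fun X => ∫ ω, ∑ i, U ω i * X ω i ∂P) inferInstance

/-- Here `Z ≤ X` is the almost sure componentwise order. -/
def IsMonotone (R : Lp (Fin d → ℝ) ∞ P → Set (Fin d → ℝ)) : Prop :=
  ∀ X Z : Lp (Fin d → ℝ) ∞ P, Z ≤ X → R Z ⊆ R X

def IsConvex (R : Lp (Fin d → ℝ) ∞ P → Set (Fin d → ℝ)) : Prop :=
  ∀ (X Z : Lp (Fin d → ℝ) ∞ P) (γ : ℝ), 0 ≤ γ → γ ≤ 1 →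
    γ • R X + (1 - γ) • R Z ⊆ R (γ • X + (1 - γ) • Z)

def IsWeakStarClosed (R : Lp (Fin d → ℝ) ∞ P → Set (Fin d → ℝ)) : Prop :=
  ∀ z : Fin d → ℝ, IsClosed[weakStarTopology d P] {X | z ∈ R X}

def IsFiniteAtZero (R : Lp (Fin d → ℝ) ∞ P → Set (Fin d → ℝ)) : Prop :=
  R 0 ≠ ∅ ∧ R 0 ≠ Set.univ

def IsTranslative (R : Lp (Fin d → ℝ) ∞ P → Set (Fin d → ℝ)) : Prop :=
  ∀ (X : Lp (Fin d → ℝ) ∞ P) (z : Fin d → ℝ),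
    R (X + Lp.const ∞ P z) = (fun x => x - z) '' R X

end

end SystemicRisk

/-! Everything except weak* closedness is a direct computation: monotonicity and convexity come from
`Λ` being increasing and concave together with `ρ`, and on constants membership reduces to an
inequality between real numbers.

For closedness, the Fatou property and the continuity of `Λ` show that `{X | z ∈ R X}` is stable
under bounded almost sure limits (`fatouClosed_aggregate`), and it is convex. The core is the
Krein–Šmulian type statement `FatouClosed.isClosed_weakStar`. Embed `L^∞_d` in the Hilbert space
`L^2_d`; norm-bounded pieces of such a set have closed image there. If `0 ∉ C`, an increasing
sequence of bounded convex sets avoiding `C` is built, each obtained from the previous one by adding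
a small `L^2`-ball cut down to norm `n + 1` (`exists_add_mixedBall`). Hahn–Banach applied to the
interior of their union gives a functional separating `0` from `C` that is continuous along bounded
sequences tending to `0` in `L^2` (`exists_separating_functional`). Such a functional is countably
additive on indicators, so Radon–Nikodym represents it by a density in `L^1_d` (`exists_density`),
and separation by a density is weak* separation. -/

namespace SystemicRisk

/-! ### Convex sets in a Hilbert space and separation -/

section Hilbert

variable {H : Type*} [NormedAddCommGroup H] [InnerProductSpace ℝ H] [CompleteSpace H]

/-- The points of least norm in the `K n` form a Cauchy sequence, by the parallelogram law. This
replaces weak compactness of bounded closed convex sets. -/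
theorem nonempty_iInter_of_antitone_convex {K : ℕ → Set H} (hanti : Antitone K)
    (hclosed : ∀ n, IsClosed (K n)) (hconv : ∀ n, Convex ℝ (K n)) (hne : ∀ n, (K n).Nonempty)
    (hbdd : Bornology.IsBounded (K 0)) : (⋂ n, K n).Nonempty := by
  have hmin : ∀ n, ∃ v ∈ K n, ∀ w ∈ K n, ‖v‖ ≤ ‖w‖ := by
    intro n
    obtain ⟨v, hv, h⟩ := exists_norm_eq_iInf_of_complete_convex (hne n) (hclosed n).isComplete
      (hconv n) 0
    refine ⟨v, hv, fun w hw => ?_⟩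
    rw [zero_sub, norm_neg] at h
    rw [h]
    have := ciInf_le (f := fun w : K n => ‖0 - (w : H)‖)
      ⟨0, by rintro _ ⟨w, rfl⟩; exact norm_nonneg _⟩ ⟨w, hw⟩
    simpa using this
  choose x hx hxmin using hmin
  obtain ⟨M, hM⟩ := hbdd.exists_norm_le
  have hmono : Monotone fun n => ‖x n‖ ^ 2 := by
    intro m n hmn
    have := hxmin m (x n) (hanti hmn (hx n))
    exact pow_le_pow_left₀ (norm_nonneg _) this 2
  have hb : BddAbove (Set.range fun n => ‖x n‖ ^ 2) := by
    refine ⟨M ^ 2, ?_⟩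
    rintro _ ⟨n, rfl⟩
    exact pow_le_pow_left₀ (norm_nonneg _) (hM _ (hanti (Nat.zero_le n) (hx n))) 2
  have hlim := tendsto_atTop_ciSup hmono hb
  set L := ⨆ n, ‖x n‖ ^ 2
  have hcauchy : CauchySeq x := by
    -- The midpoint of `x n` and `x m` lies in `K n`, so `‖x n + x m‖ ≥ 2‖x n‖`; the parallelogram
    -- law then gives exactly this bound.
    refine cauchySeq_of_le_tendsto_0' (fun n => √(2 * (L - ‖x n‖ ^ 2))) ?_ ?_
    · intro n m hnm
      rw [dist_eq_norm]
      refine Real.le_sqrt_of_sq_le ?_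
      have hmid : ‖x n‖ ≤ ‖(1 / 2 : ℝ) • x n + (1 / 2 : ℝ) • x m‖ :=
        hxmin n _ (hconv n (hx n) (hanti hnm (hx m)) (by norm_num) (by norm_num) (by norm_num))
      rw [← smul_add, norm_smul, Real.norm_of_nonneg (by norm_num)] at hmid
      have hpar := parallelogram_law_with_norm ℝ (x n) (x m)
      have hL : ‖x m‖ ^ 2 ≤ L := le_ciSup hb m
      have h0 := norm_nonneg (x n)
      nlinarith [norm_nonneg (x n + x m)]
    · have : Tendsto (fun n => √(2 * (L - ‖x n‖ ^ 2))) atTop (𝓝 √(2 * (L - L))) :=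
        ((tendsto_const_nhds.sub hlim).const_mul 2).sqrt
      simpa using this
  obtain ⟨y, hy⟩ := cauchySeq_tendsto_of_complete hcauchy
  refine ⟨y, Set.mem_iInter.2 fun n => (hclosed n).mem_of_tendsto hy ?_⟩
  filter_upwards [eventually_ge_atTop n] with m hm using hanti hm (hx m)

/-- For `x` in the closure, the points `s ∈ A` with `x - s` within `1 / (k + 1)` of `B` form nested
nonempty closed convex bounded sets; a common point splits `x`. -/
theorem isClosed_add_of_convex {A B : Set H} (hA : IsClosed A) (hAc : Convex ℝ A)
    (hAb : Bornology.IsBounded A) (hB : IsClosed B) (hBc : Convex ℝ B) : IsClosed (A + B) := by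
  refine isClosed_of_closure_subset fun x hx => ?_
  let δ : ℕ → ℝ := fun k => 1 / (k + 1)
  have hδ : ∀ k, 0 < δ k := fun k => Nat.one_div_pos_of_nat
  have hcont : Continuous fun s : H => x - s := by fun_prop
  obtain ⟨s, hs⟩ := nonempty_iInter_of_antitone_convex
    (K := fun k => A ∩ (fun s => x - s) ⁻¹' Metric.cthickening (δ k) B)
    (fun m n hmn => Set.inter_subset_inter_right _ (Set.preimage_mono
      (Metric.cthickening_mono (Nat.one_div_le_one_div hmn) B)))
    (fun k => hA.inter (Metric.isClosed_cthickening.preimage hcont))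
    (fun k => hAc.inter (by
      intro a ha b hb p q hp hq hpq
      have := (hBc.cthickening (δ k)) ha hb hp hq hpq
      have he : x - (p • a + q • b) = p • (x - a) + q • (x - b) := by
        rw [smul_sub, smul_sub]
        nth_rw 1 [← one_smul ℝ x]
        rw [← hpq, add_smul]
        abel
      simpa [he] using this))
    (fun k => by
      obtain ⟨z, ⟨a, ha, b, hb, rfl⟩, hz⟩ := Metric.mem_closure_iff.1 hx (δ k) (hδ k)
      refine ⟨a, ha, Metric.mem_cthickening_of_dist_le _ b _ _ hb ?_⟩
      rw [dist_eq_norm] at hz ⊢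
      rw [sub_sub]
      exact hz.le)
    (hAb.subset Set.inter_subset_left)
  rw [Set.mem_iInter] at hs
  refine ⟨s, (hs 0).1, x - s, ?_, by simp⟩
  rw [← hB.closure_eq, Metric.mem_closure_iff_infDist_zero]
  · refine le_antisymm (ge_of_tendsto' tendsto_one_div_add_atTop_nhds_zero_nat fun k => ?_)
      Metric.infDist_nonneg
    have h := (hs k).2
    rw [Set.mem_preimage, Metric.mem_cthickening_iff] at h
    exact ENNReal.toReal_le_of_le_ofReal (hδ k).le h
  · obtain ⟨_, ⟨_, _, b, hb, _⟩, _⟩ := Metric.mem_closure_iff.1 hx 1 one_pos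
    exact ⟨b, hb⟩

theorem exists_pos_le_norm_sub_of_disjoint {A B : Set H} (hA : IsClosed A) (hAc : Convex ℝ A)
    (hAb : Bornology.IsBounded A) (hB : IsClosed B) (hBc : Convex ℝ B) (hAB : Disjoint A B) :
    ∃ δ > 0, ∀ a ∈ A, ∀ b ∈ B, δ ≤ ‖a - b‖ := by
  have hcl : IsClosed (A + -B) := isClosed_add_of_convex hA hAc hAb hB.neg hBc.neg
  have h0 : (0 : H) ∈ (A + -B)ᶜ := by
    rintro ⟨a, ha, b, hb, hab⟩
    obtain rfl : a = -b := eq_neg_of_add_eq_zero_left hab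
    exact Set.disjoint_left.1 hAB ha hb
  obtain ⟨δ, hδ, hball⟩ := Metric.isOpen_iff.1 hcl.isOpen_compl 0 h0
  refine ⟨δ, hδ, fun a ha b hb => ?_⟩
  by_contra! hlt
  exact hball (by simpa using hlt) ⟨a, ha, -b, by simpa using hb, by simp [sub_eq_add_neg]⟩

variable {E : Type*} [NormedAddCommGroup E] [NormedSpace ℝ E]

/-- The vectors of norm at most `r` in `E` whose image in `H` has norm at most `ε`. -/
def mixedBall (J : E →L[ℝ] H) (r ε : ℝ) : Set E :=
  Metric.closedBall 0 r ∩ J ⁻¹' Metric.closedBall 0 ε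

/-- Bounded convex sets with closed image in `H` that avoid `C`. -/
structure AvoidingSet (J : E →L[ℝ] H) (C S : Set E) : Prop where
  convex : Convex ℝ S
  bounded : Bornology.IsBounded S
  closed : IsClosed (J '' S)
  disjoint : Disjoint S C
  zero_mem : 0 ∈ S

variable {J : E →L[ℝ] H} {C : Set E}

/-- Only the part of `C` in the ball of radius `R + r` can meet the enlarged set, and its image lies
at positive distance `δ` from that of `S`; moving by at most `δ / 2` in `H` cannot reach it. -/
theorem AvoidingSet.exists_add_mixedBall {S : Set E} (hS : AvoidingSet J C S)
    (hJ : Function.Injective J) (hball : ∀ r, IsClosed (J '' Metric.closedBall 0 r))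
    (hC : Convex ℝ C) (hCcl : ∀ r, IsClosed (J '' (C ∩ Metric.closedBall 0 r)))
    {r : ℝ} (hr : 0 ≤ r) : ∃ ε > 0, AvoidingSet J C (S + mixedBall J r ε) := by
  obtain ⟨R, hR⟩ := hS.bounded.exists_norm_le
  obtain ⟨δ, hδ, hdist⟩ := exists_pos_le_norm_sub_of_disjoint hS.closed
    (hS.convex.linear_image J.toLinearMap)
    (J.lipschitz.isBounded_image hS.bounded) (hCcl (R + r))
    ((hC.inter (convex_closedBall 0 (R + r))).linear_image J.toLinearMap)
    ((Set.disjoint_image_iff hJ).2 (hS.disjoint.mono_right Set.inter_subset_left))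
  have hTconv : Convex ℝ (mixedBall J r (δ / 2)) :=
    (convex_closedBall 0 r).inter ((convex_closedBall 0 (δ / 2)).linear_preimage J.toLinearMap)
  have hTb : Bornology.IsBounded (mixedBall J r (δ / 2)) :=
    Metric.isBounded_closedBall.subset Set.inter_subset_left
  refine ⟨δ / 2, half_pos hδ, hS.convex.add hTconv, hS.bounded.add hTb, ?_, ?_, ?_⟩
  · rw [Set.image_add]
    refine isClosed_add_of_convex hS.closed (hS.convex.linear_image J.toLinearMap)
      (J.lipschitz.isBounded_image hS.bounded) ?_ (hTconv.linear_image J.toLinearMap)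
    rw [mixedBall, Set.image_inter_preimage]
    exact (hball r).inter Metric.isClosed_closedBall
  · rw [Set.disjoint_left]
    rintro _ ⟨s, hs, t, ht, rfl⟩ hst
    have h1 : ‖s + t‖ ≤ R + r :=
      (norm_add_le _ _).trans (add_le_add (hR s hs) (by simpa using ht.1))
    have h2 := hdist (J s) ⟨s, hs, rfl⟩ (J (s + t)) ⟨s + t, ⟨hst, by simpa using h1⟩, rfl⟩
    have h3 : ‖J t‖ ≤ δ / 2 := by simpa using ht.2
    rw [map_add, sub_add_cancel_left, norm_neg] at h2
    linarith
  · exact ⟨0, hS.zero_mem, 0, ⟨by simpa using hr, by simpa using (half_pos hδ).le⟩, by simp⟩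

/-- The union `V` of the avoiding sets contains a mixed ball of every radius, so any functional
bounded above on its interior is small on bounded sequences whose images tend to `0`. -/
theorem exists_separating_functional (hJ : Function.Injective J)
    (hball : ∀ r, IsClosed (J '' Metric.closedBall 0 r))
    (hC : Convex ℝ C) (hCcl : ∀ r, IsClosed (J '' (C ∩ Metric.closedBall 0 r)))
    (h0 : 0 ∉ C) :
    ∃ (f : E →L[ℝ] ℝ) (u : ℝ), 0 < u ∧ (∀ c ∈ C, u ≤ f c) ∧
      ∀ x : ℕ → E, (∃ M : ℝ, ∀ n, ‖x n‖ ≤ M) → Tendsto (fun n => J (x n)) atTop (𝓝 0) →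
        Tendsto (fun n => f (x n)) atTop (𝓝 0) := by
  have hzero : AvoidingSet J C {0} :=
    ⟨convex_singleton 0, Bornology.isBounded_singleton, by simp, by simpa using h0, rfl⟩
  choose ε hε hstep using fun (S : {S // AvoidingSet J C S}) (n : ℕ) =>
    S.2.exists_add_mixedBall hJ hball hC hCcl (show (0 : ℝ) ≤ (n : ℝ) + 1 by positivity)
  let S : ℕ → {S // AvoidingSet J C S} := fun n =>
    Nat.rec ⟨{0}, hzero⟩ (fun k S => ⟨_, hstep S k⟩) n
  have hS : ∀ n : ℕ, (S (n + 1)).1 = (S n).1 + mixedBall J ((n : ℝ) + 1) (ε (S n) n) :=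
    fun n => rfl
  have hmono : Monotone fun n => (S n).1 := by
    refine monotone_nat_of_le_succ fun n => ?_
    rw [hS]
    refine Set.subset_add_left _ ⟨?_, ?_⟩
    · simp; positivity
    · simpa using (hε (S n) n).le
  have hT : ∀ n : ℕ, mixedBall J ((n : ℝ) + 1) (ε (S n) n) ⊆ (S (n + 1)).1 := fun n => by
    rw [hS]
    exact Set.subset_add_right _ (S n).2.zero_mem
  let V : Set E := ⋃ n, (S n).1
  have hVconv : Convex ℝ V := hmono.directed_le.convex_iUnion fun n => (S n).2.convex
  have hVC : Disjoint V C := Set.disjoint_iUnion_left.2 fun n => (S n).2.disjoint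
  have hint : ∀ (n : ℕ) (x : E), ‖x‖ < n + 1 → ‖J x‖ < ε (S n) n → x ∈ interior V := by
    intro n x hx hJx
    refine mem_interior.2 ⟨{x | ‖x‖ < n + 1} ∩ {x | ‖J x‖ < ε (S n) n}, ?_, ?_, hx, hJx⟩
    · rintro y ⟨hy, hJy⟩
      refine Set.mem_iUnion.2 ⟨n + 1, hT n ⟨?_, ?_⟩⟩
      · simpa using le_of_lt hy
      · simpa using le_of_lt hJy
    · exact (isOpen_lt (by fun_prop) continuous_const).inter
        (isOpen_lt (by fun_prop) continuous_const)
  obtain ⟨f, u, hfV, hfC⟩ := geometric_hahn_banach_open hVconv.interior isOpen_interior hC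
    (hVC.mono_left interior_subset)
  have hu : 0 < u := by
    have := hfV 0 (hint 0 0 (by simp) (by simpa using hε (S 0) 0))
    simpa using this
  refine ⟨f, u, hu, hfC, fun x ⟨M, hM⟩ hx => ?_⟩
  rw [Metric.tendsto_atTop]
  intro η hη
  -- Dividing by `c` brings `± x k` into the interior of `V`, where `f < u`; scaling back gives `± f
  -- (x k) < c * u = η`.
  set c : ℝ := η / u with hc
  have hcpos : 0 < c := div_pos hη hu
  obtain ⟨n, hn⟩ := exists_nat_gt (M / c)
  have hev : ∀ᶠ k in atTop, ‖J (x k)‖ < c * ε (S n) n :=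
    (tendsto_zero_iff_norm_tendsto_zero.1 hx).eventually_lt_const (mul_pos hcpos (hε _ _))
  obtain ⟨N, hN⟩ := eventually_atTop.1 hev
  refine ⟨N, fun k hk => ?_⟩
  have hbound : ∀ s : ℝ, |s| = 1 → s * f (x k) < η := by
    intro s hs
    have hmem : (s * c⁻¹) • x k ∈ interior V := by
      refine hint n _ ?_ ?_
      · rw [norm_smul, norm_mul, Real.norm_eq_abs, hs, one_mul, norm_inv,
          Real.norm_of_nonneg hcpos.le, inv_mul_eq_div, div_lt_iff₀ hcpos]
        rw [div_lt_iff₀ hcpos] at hn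
        nlinarith [hM k]
      · rw [map_smul, norm_smul, norm_mul, Real.norm_eq_abs, hs, one_mul, norm_inv,
          Real.norm_of_nonneg hcpos.le, inv_mul_eq_div, div_lt_iff₀ hcpos, mul_comm]
        exact hN k hk
    have := hfV _ hmem
    rw [map_smul, smul_eq_mul, mul_right_comm, ← div_eq_mul_inv, div_lt_iff₀ hcpos, hc,
      mul_div_cancel₀ _ hu.ne'] at this
    exact this
  rw [Real.dist_eq, sub_zero, abs_lt]
  constructor
  · linarith [hbound (-1) (by simp)]
  · linarith [hbound 1 (by simp)]

end Hilbert

theorem hasSum_indicator_iUnion {α : Type*} {A : ℕ → Set α}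
    (hA : Pairwise (Function.onFun Disjoint A)) (ω : α) : HasSum (fun i => (A i).indicator (fun _ => (1 : ℝ)) ω)
      ((⋃ i, A i).indicator (fun _ => (1 : ℝ)) ω) := by
  by_cases h : ∃ j, ω ∈ A j
  · obtain ⟨j, hj⟩ := h
    rw [Set.indicator_of_mem (Set.mem_iUnion.2 ⟨j, hj⟩)]
    convert hasSum_single j ?_ using 1
    · rw [Set.indicator_of_mem hj]
    · intro i hi
      exact Set.indicator_of_notMem (fun hi' => Set.disjoint_left.1 (hA hi) hi' hj) _
  · rw [Set.indicator_of_notMem (by simpa using h)]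
    convert hasSum_zero using 2 with i
    exact Set.indicator_of_notMem (fun hi => h ⟨i, hi⟩) _

variable {Ω : Type*} [MeasurableSpace Ω]

/-! ### Bounded almost sure convergence in `L^∞` -/

section LpTop

variable {P : Measure Ω} {F : Type*} [NormedAddCommGroup F]

theorem ae_norm_le_norm (X : Lp F ∞ P) : ∀ᵐ ω ∂P, ‖X ω‖ ≤ ‖X‖ := by
  filter_upwards [enorm_ae_le_eLpNormEssSup (X : Ω → F) P] with ω hω
  rw [Lp.norm_def, ← toReal_enorm, eLpNorm_exponent_top]
  exact ENNReal.toReal_mono (by simpa using Lp.eLpNorm_ne_top X) hω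

theorem norm_le_of_ae_norm_le [IsProbabilityMeasure P] {X : Lp F ∞ P} {C : ℝ} (hC : 0 ≤ C)
    (h : ∀ᵐ ω ∂P, ‖X ω‖ ≤ C) : ‖X‖ ≤ C := by
  simpa [measureUnivNNReal] using Lp.norm_le_of_ae_bound hC h

variable [NormedSpace ℝ F]

/-- Sequential continuity at zero along bounded sequences that converge almost surely. -/
def BoundedlyContinuous (f : Lp F ∞ P →L[ℝ] ℝ) : Prop :=
  ∀ X : ℕ → Lp F ∞ P, (∃ M : ℝ, ∀ n, ‖X n‖ ≤ M) →
    (∀ᵐ ω ∂P, Tendsto (fun n => X n ω) atTop (𝓝 0)) → Tendsto (fun n => f (X n)) atTop (𝓝 0)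

theorem BoundedlyContinuous.tendsto {f : Lp F ∞ P →L[ℝ] ℝ} (hf : BoundedlyContinuous f)
    {X : ℕ → Lp F ∞ P} {Y : Lp F ∞ P} (hb : ∃ M : ℝ, ∀ n, ‖X n‖ ≤ M)
    (h : ∀ᵐ ω ∂P, Tendsto (fun n => X n ω) atTop (𝓝 (Y ω))) :
    Tendsto (fun n => f (X n)) atTop (𝓝 (f Y)) := by
  obtain ⟨M, hM⟩ := hb
  have := hf (fun n => X n - Y)
    ⟨M + ‖Y‖, fun n => (norm_sub_le _ _).trans (by gcongr; exact hM n)⟩ (by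
      filter_upwards [h, ae_all_iff.2 fun n => Lp.coeFn_sub (X n) Y] with ω hω hsub
      simp only [hsub, Pi.sub_apply]
      exact tendsto_sub_nhds_zero_iff.2 hω)
  simpa only [map_sub, tendsto_sub_nhds_zero_iff] using this

end LpTop

section Pairing

variable {P : Measure Ω} {d : ℕ}

theorem integrable_mul_coeFn_top {U : Ω → ℝ} (hU : Integrable U P) (Y : Lp ℝ ∞ P) :
    Integrable (fun ω => U ω * Y ω) P :=
  hU.mul_bdd (Lp.aestronglyMeasurable Y) (ae_norm_le_norm Y)

theorem integrable_dualPairing (U : Lp (Fin d → ℝ) 1 P) (X : Lp (Fin d → ℝ) ∞ P) :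
    Integrable (fun ω => ∑ i, U ω i * X ω i) P := by
  refine integrable_finsetSum _ fun i _ => ?_
  have hU : Integrable (fun ω => U ω i) P := (L1.integrable_coeFn U).eval i
  refine hU.mul_bdd (c := ‖X‖)
    ((continuous_apply i).comp_aestronglyMeasurable (Lp.aestronglyMeasurable X)) ?_
  filter_upwards [ae_norm_le_norm X] with ω hω
  exact (norm_le_pi_norm (X ω) i).trans hω

end Pairing

/-! ### Densities of boundedly continuous functionals -/

section RadonNikodym

variable {P : Measure Ω} [IsProbabilityMeasure P]

open Classical in
/-- The indicator of a set in `L^∞`; zero for sets that are not measurable. -/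
noncomputable def indicatorTop (P : Measure Ω) [IsProbabilityMeasure P] (A : Set Ω) : Lp ℝ ∞ P :=
  if h : MeasurableSet A then indicatorConstLp ∞ h (measure_ne_top P A) 1 else 0

theorem coeFn_indicatorTop {A : Set Ω} (h : MeasurableSet A) :
    indicatorTop P A =ᵐ[P] A.indicator fun _ => 1 := by
  rw [indicatorTop, dif_pos h]
  exact indicatorConstLp_coeFn

theorem hasSum_indicatorTop {f : Lp ℝ ∞ P →L[ℝ] ℝ} (hf : BoundedlyContinuous f)
    {A : ℕ → Set Ω} (hm : ∀ i, MeasurableSet (A i)) (hA : Pairwise (Function.onFun Disjoint A)) :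
    HasSum (fun i => f (indicatorTop P (A i))) (f (indicatorTop P (⋃ i, A i))) := by
  -- `atTop` on finite subsets of `ℕ` is countably generated, so sequences of partial sums suffice;
  -- by disjointness they are bounded by `1`.
  refine tendsto_of_seq_tendsto fun s hs => ?_
  simp only [← map_sum]
  have hcoe : ∀ᵐ ω ∂P, ∀ n, (∑ i ∈ s n, indicatorTop P (A i) : Lp ℝ ∞ P) ω =
      ∑ i ∈ s n, (A i).indicator (fun _ => (1 : ℝ)) ω := by
    rw [ae_all_iff]
    intro n
    filter_upwards [Lp.coeFn_finsetSum (s n) fun i => indicatorTop P (A i),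
      ae_all_iff.2 fun i => coeFn_indicatorTop (P := P) (hm i)] with ω h1 h2
    rw [h1, Finset.sum_apply]
    exact Finset.sum_congr rfl fun i _ => h2 i
  refine hf.tendsto ⟨1, fun n => norm_le_of_ae_norm_le zero_le_one ?_⟩ ?_
  · filter_upwards [hcoe] with ω hω
    have hnn : ∀ i, 0 ≤ (A i).indicator (fun _ => (1 : ℝ)) ω := fun i =>
      Set.indicator_nonneg (fun _ _ => zero_le_one) ω
    rw [hω, Real.norm_of_nonneg (Finset.sum_nonneg fun i _ => hnn i)]
    exact (sum_le_hasSum _ (fun i _ => hnn i) (hasSum_indicator_iUnion hA ω)).trans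
      (Set.indicator_le_self' (fun _ _ => zero_le_one) ω)
  · filter_upwards [hcoe, coeFn_indicatorTop (P := P) (MeasurableSet.iUnion hm)] with ω hω hU
    simp only [hω, hU]
    exact (hasSum_indicator_iUnion hA ω).comp hs

/-- The signed measure `A ↦ f(1_A)`. -/
noncomputable def signedMeasureOf {f : Lp ℝ ∞ P →L[ℝ] ℝ} (hf : BoundedlyContinuous f) :
    SignedMeasure Ω where
  measureOf' A := f (indicatorTop P A)
  empty' := by simp [indicatorTop]
  not_measurable' A hA := by simp [indicatorTop, hA]
  m_iUnion' _ hm hA := hasSum_indicatorTop hf hm hA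

/-- Indicators of null sets vanish in `L^∞`, so the signed measure is absolutely continuous. -/
theorem exists_density_indicator {f : Lp ℝ ∞ P →L[ℝ] ℝ} (hf : BoundedlyContinuous f) :
    ∃ U : Ω → ℝ, Integrable U P ∧
      ∀ A, MeasurableSet A → f (indicatorTop P A) = ∫ ω in A, U ω ∂P := by
  refine ⟨(signedMeasureOf hf).rnDeriv P, SignedMeasure.integrable_rnDeriv _ _, fun A hA => ?_⟩
  rw [← withDensityᵥ_apply (SignedMeasure.integrable_rnDeriv _ _) hA,
    (SignedMeasure.absolutelyContinuous_iff_withDensityᵥ_rnDeriv_eq _ _).1]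
  · rfl
  · intro B hB
    by_cases hBm : MeasurableSet B
    · rw [Measure.toENNRealVectorMeasure_apply_measurable hBm] at hB
      have h0 : indicatorTop P B = 0 := by
        refine Lp.ext ?_
        filter_upwards [coeFn_indicatorTop (P := P) hBm, Lp.coeFn_zero ℝ ∞ P,
          measure_eq_zero_iff_ae_notMem.1 hB] with ω h1 h2 h3
        rw [h1, h2, Set.indicator_of_notMem h3]
        rfl
      change f (indicatorTop P B) = 0
      rw [h0, map_zero]
    · exact VectorMeasure.not_measurable _ hBm

theorem exists_density_real {f : Lp ℝ ∞ P →L[ℝ] ℝ} (hf : BoundedlyContinuous f) :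
    ∃ U : Ω → ℝ, Integrable U P ∧ ∀ Y : Lp ℝ ∞ P, f Y = ∫ ω, U ω * Y ω ∂P := by
  obtain ⟨U, hU, hUA⟩ := exists_density_indicator hf
  refine ⟨U, hU, fun Y => ?_⟩
  have hsimple : ∀ φ : SimpleFunc Ω ℝ,
      f ((φ.memLp_top P).toLp φ) = ∫ ω, U ω * φ ω ∂P := by
    intro φ
    induction φ using SimpleFunc.induction with
    | const c hs =>
      rename_i s
      have h1 : (SimpleFunc.memLp_top (SimpleFunc.piecewise s hs (SimpleFunc.const Ω c)
          (SimpleFunc.const Ω 0)) P).toLp _ = c • indicatorTop P s := by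
        refine Lp.ext ?_
        filter_upwards [MemLp.coeFn_toLp (SimpleFunc.memLp_top (SimpleFunc.piecewise s hs
          (SimpleFunc.const Ω c) (SimpleFunc.const Ω 0)) P), Lp.coeFn_smul c (indicatorTop P s),
          coeFn_indicatorTop (P := P) hs] with ω h1 h2 h3
        rw [h1, h2, Pi.smul_apply, h3]
        by_cases hω : ω ∈ s <;> simp [hω]
      rw [h1, map_smul, hUA s hs, smul_eq_mul, ← integral_const_mul, ← integral_indicator hs]
      refine integral_congr_ae (ae_of_all _ fun ω => ?_)
      by_cases hω : ω ∈ s <;> simp [hω, mul_comm]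
    | add hd h1 h2 =>
      rename_i φ ψ
      have h : (SimpleFunc.memLp_top (φ + ψ) P).toLp _ =
          (φ.memLp_top P).toLp φ + (ψ.memLp_top P).toLp ψ := MemLp.toLp_add _ _
      rw [h, map_add, h1, h2, ← integral_add]
      · simp [mul_add]
      · exact (hU.mul_of_top_left (φ.memLp_top P))
      · exact (hU.mul_of_top_left (ψ.memLp_top P))
  have hYm : Measurable (Y : Ω → ℝ) := (Lp.stronglyMeasurable Y).measurable
  -- Starting the approximation at `0` keeps it below `2‖Y‖`, so both sides pass to the limit.
  let φ : ℕ → SimpleFunc Ω ℝ := SimpleFunc.approxOn Y hYm Set.univ 0 (Set.mem_univ _)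
  have hφ : ∀ ω, Tendsto (fun n => φ n ω) atTop (𝓝 (Y ω)) := fun ω =>
    SimpleFunc.tendsto_approxOn hYm _ (by simp)
  have hφb : ∀ᵐ ω ∂P, ∀ n, ‖φ n ω‖ ≤ 2 * ‖Y‖ := by
    filter_upwards [ae_norm_le_norm Y] with ω hω n
    have := SimpleFunc.norm_approxOn_zero_le hYm (Set.mem_univ 0) ω n
    linarith
  have hcoe := ae_all_iff.2 fun n => MemLp.coeFn_toLp ((φ n).memLp_top P)
  have hlim1 : Tendsto (fun n => f (((φ n).memLp_top P).toLp (φ n))) atTop (𝓝 (f Y)) := by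
    refine hf.tendsto ⟨2 * ‖Y‖, fun n => norm_le_of_ae_norm_le (by positivity) ?_⟩ ?_
    · filter_upwards [hφb, hcoe] with ω h1 h2
      rw [h2]
      exact h1 n
    · filter_upwards [hcoe] with ω h
      simpa only [h] using hφ ω
  refine tendsto_nhds_unique hlim1 ?_
  simp only [hsimple]
  refine tendsto_integral_of_dominated_convergence (fun ω => ‖U ω‖ * (2 * ‖Y‖))
    (fun n => hU.1.mul (φ n).aestronglyMeasurable) (hU.norm.mul_const _) (fun n => ?_)
    (ae_of_all _ fun ω => (hφ ω).const_mul _)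
  filter_upwards [hφb] with ω h
  rw [norm_mul]
  gcongr
  exact h n

variable {d : ℕ}

theorem exists_density {f : Lp (Fin d → ℝ) ∞ P →L[ℝ] ℝ} (hf : BoundedlyContinuous f) :
    ∃ U : Lp (Fin d → ℝ) 1 P, ∀ X : Lp (Fin d → ℝ) ∞ P,
      f X = ∫ ω, ∑ i, U ω i * X ω i ∂P := by
  let e : ∀ i : Fin d, Lp ℝ ∞ P →L[ℝ] Lp (Fin d → ℝ) ∞ P := fun i =>
    (ContinuousLinearMap.single ℝ (fun _ : Fin d => ℝ) i).compLpL ∞ P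
  let π : ∀ i : Fin d, Lp (Fin d → ℝ) ∞ P →L[ℝ] Lp ℝ ∞ P := fun i =>
    (ContinuousLinearMap.proj (R := ℝ) (φ := fun _ : Fin d => ℝ) i).compLpL ∞ P
  have he : ∀ i Y, e i Y =ᵐ[P] fun ω => Pi.single i (Y ω) := fun i Y =>
    ContinuousLinearMap.coeFn_compLpL _ Y
  have hπ : ∀ i X, π i X =ᵐ[P] fun ω => X ω i := fun i X =>
    ContinuousLinearMap.coeFn_compLpL _ X
  have hfe : ∀ i, BoundedlyContinuous (f.comp (e i)) := by
    rintro i Y ⟨M, hM⟩ hY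
    refine hf (fun n => e i (Y n)) ⟨‖e i‖ * M, fun n => ?_⟩ ?_
    · exact ((e i).le_opNorm _).trans (by gcongr; exact hM n)
    · filter_upwards [hY, ae_all_iff.2 fun n => he i (Y n)] with ω h1 h2
      simp only [h2]
      have := ((ContinuousLinearMap.single ℝ (fun _ : Fin d => ℝ) i).continuous.tendsto 0).comp h1
      simpa [Function.comp_def] using this
  choose U hU hUf using fun i => exists_density_real (hfe i)
  have hUint : Integrable (fun ω i => U i ω) P := Integrable.of_eval hU
  refine ⟨(memLp_one_iff_integrable.2 hUint).toLp _, fun X => ?_⟩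
  have hX : X = ∑ i, e i (π i X) := by
    refine Lp.ext ?_
    filter_upwards [Lp.coeFn_finsetSum Finset.univ fun i => e i (π i X),
      ae_all_iff.2 fun i => he i (π i X), ae_all_iff.2 fun i => hπ i X] with ω h1 h2 h3
    rw [h1, Finset.sum_apply]
    simp only [h2, h3]
    exact (Finset.univ_sum_single (X ω)).symm
  have hfX : f X = ∑ i, f (e i (π i X)) := by
    conv_lhs => rw [hX]
    exact map_sum f _ _
  have hterm : ∀ i, f (e i (π i X)) = ∫ ω, U i ω * π i X ω ∂P := fun i => hUf i (π i X)
  rw [hfX]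
  simp only [hterm]
  rw [← integral_finsetSum _ fun i _ => integrable_mul_coeFn_top (hU i) (π i X)]
  refine integral_congr_ae ?_
  filter_upwards [MemLp.coeFn_toLp (memLp_one_iff_integrable.2 hUint),
    ae_all_iff.2 fun i => hπ i X] with ω h1 h2
  simp only [h1, h2]

end RadonNikodym

/-! ### From bounded almost sure closedness to weak* closedness -/

section WeakStar

variable {P : Measure Ω} [IsProbabilityMeasure P] {d : ℕ}

theorem memLp_two_toEuclidean (X : Lp (Fin d → ℝ) ∞ P) :
    MemLp (fun ω => (WithLp.toLp 2 (X ω) : EuclideanSpace ℝ (Fin d))) 2 P := by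
  have h : MemLp (fun ω => (EuclideanSpace.equiv (Fin d) ℝ).symm (X ω)) ∞ P :=
    (EuclideanSpace.equiv (Fin d) ℝ).symm.toContinuousLinearMap.comp_memLp X
  exact h.mono_exponent le_top

/-- The inclusion of `L^∞_d` into the Hilbert space `L^2_d`. -/
noncomputable def toL2 (d : ℕ) (P : Measure Ω) [IsProbabilityMeasure P] :
    Lp (Fin d → ℝ) ∞ P →L[ℝ] Lp (EuclideanSpace ℝ (Fin d)) 2 P :=
  LinearMap.mkContinuous
    { toFun := fun X => (memLp_two_toEuclidean X).toLp _
      map_add' := fun X Y => by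
        refine Lp.ext ?_
        filter_upwards [MemLp.coeFn_toLp (memLp_two_toEuclidean (X + Y)),
          MemLp.coeFn_toLp (memLp_two_toEuclidean X), MemLp.coeFn_toLp (memLp_two_toEuclidean Y),
          Lp.coeFn_add X Y, Lp.coeFn_add ((memLp_two_toEuclidean X).toLp _)
            ((memLp_two_toEuclidean Y).toLp _)] with ω h1 h2 h3 h4 h5
        rw [h1, h5, Pi.add_apply, h2, h3, h4, Pi.add_apply, WithLp.toLp_add]
      map_smul' := fun c X => by
        refine Lp.ext ?_
        filter_upwards [MemLp.coeFn_toLp (memLp_two_toEuclidean (c • X)),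
          MemLp.coeFn_toLp (memLp_two_toEuclidean X),
          Lp.coeFn_smul c X, Lp.coeFn_smul c ((memLp_two_toEuclidean X).toLp _)]
          with ω h1 h2 h3 h4
        rw [h1, RingHom.id_apply, h4, Pi.smul_apply, h2, h3, Pi.smul_apply, WithLp.toLp_smul] }
    ‖((EuclideanSpace.equiv (Fin d) ℝ).symm : (Fin d → ℝ) →L[ℝ] EuclideanSpace ℝ (Fin d))‖
    fun X => by
      have h := Lp.norm_le_of_ae_bound (f := (memLp_two_toEuclidean X).toLp _)
        (C := ‖((EuclideanSpace.equiv (Fin d) ℝ).symm :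
          (Fin d → ℝ) →L[ℝ] EuclideanSpace ℝ (Fin d))‖ * ‖X‖) (by positivity) (by
          filter_upwards [MemLp.coeFn_toLp (memLp_two_toEuclidean X), ae_norm_le_norm X]
            with ω h1 h2
          rw [h1]
          exact (((EuclideanSpace.equiv (Fin d) ℝ).symm :
            (Fin d → ℝ) →L[ℝ] EuclideanSpace ℝ (Fin d)).le_opNorm (X ω)).trans
              (by gcongr))
      simpa [measureUnivNNReal] using h

theorem coeFn_toL2 (X : Lp (Fin d → ℝ) ∞ P) :
    toL2 d P X =ᵐ[P] fun ω => WithLp.toLp 2 (X ω) :=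
  MemLp.coeFn_toLp (memLp_two_toEuclidean X)

theorem toL2_injective : Function.Injective (toL2 d P) := by
  intro X Y h
  refine Lp.ext ?_
  filter_upwards [coeFn_toL2 X, coeFn_toL2 Y] with ω h1 h2
  rw [h, h2] at h1
  exact (WithLp.toLp_injective 2 h1).symm

theorem tendsto_toL2 {X : ℕ → Lp (Fin d → ℝ) ∞ P} (hb : ∃ M : ℝ, ∀ n, ‖X n‖ ≤ M)
    (h : ∀ᵐ ω ∂P, Tendsto (fun n => X n ω) atTop (𝓝 0)) :
    Tendsto (fun n => toL2 d P (X n)) atTop (𝓝 0) := by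
  obtain ⟨M, hM⟩ := hb
  set e : (Fin d → ℝ) →L[ℝ] EuclideanSpace ℝ (Fin d) :=
    ((EuclideanSpace.equiv (Fin d) ℝ).symm : (Fin d → ℝ) →L[ℝ] EuclideanSpace ℝ (Fin d))
  have hsq : ∀ n, ‖toL2 d P (X n)‖ ^ 2 = ∫ ω, ‖e (X n ω)‖ ^ 2 ∂P := by
    intro n
    rw [← real_inner_self_eq_norm_sq, L2.inner_def]
    refine integral_congr_ae ?_
    filter_upwards [coeFn_toL2 (X n)] with ω hω
    rw [hω, real_inner_self_eq_norm_sq]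
    rfl
  have hlim : Tendsto (fun n => ‖toL2 d P (X n)‖ ^ 2) atTop (𝓝 (∫ _, (0 : ℝ) ∂P)) := by
    simp only [hsq]
    refine tendsto_integral_of_dominated_convergence (fun _ => (‖e‖ * M) ^ 2)
      (fun n => ?_) (integrable_const _) (fun n => ?_) ?_
    · exact ((e.continuous.comp_aestronglyMeasurable (Lp.aestronglyMeasurable (X n))).norm.pow 2)
    · filter_upwards [ae_norm_le_norm (X n)] with ω hω
      rw [norm_pow, norm_norm]
      gcongr
      exact (e.le_opNorm _).trans (by gcongr; exact hω.trans (hM n))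
    · filter_upwards [h] with ω hω
      simpa using (((e.continuous.tendsto 0).comp hω).norm.pow 2)
  rw [tendsto_zero_iff_norm_tendsto_zero]
  have := hlim.sqrt
  simpa using this

/-- Closedness under bounded almost sure convergence of sequences. -/
def FatouClosed (C : Set (Lp (Fin d → ℝ) ∞ P)) : Prop :=
  ∀ (X : ℕ → Lp (Fin d → ℝ) ∞ P) (Y : Lp (Fin d → ℝ) ∞ P), (∃ M : ℝ, ∀ n, ‖X n‖ ≤ M) →
    (∀ᵐ ω ∂P, Tendsto (fun n => X n ω) atTop (𝓝 (Y ω))) → (∀ n, X n ∈ C) → Y ∈ C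

/-- An `L^2`-convergent sequence has an almost surely convergent subsequence, and the uniform bound
`r` passes to the limit, which therefore lies in `L^∞`. -/
theorem FatouClosed.isClosed_image_toL2 {C : Set (Lp (Fin d → ℝ) ∞ P)} (hC : FatouClosed C)
    (r : ℝ) : IsClosed (toL2 d P '' (C ∩ Metric.closedBall 0 r)) := by
  refine IsSeqClosed.isClosed fun h h₀ hh hlim => ?_
  choose X hXmem hX using hh
  have hXr : ∀ n, ‖X n‖ ≤ r := fun n => by simpa using (hXmem n).2
  have hr : 0 ≤ r := (norm_nonneg _).trans (hXr 0)
  obtain ⟨ns, -, hns⟩ := (tendstoInMeasure_of_tendsto_Lp hlim).exists_seq_tendsto_ae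
  have hconv : ∀ᵐ ω ∂P, Tendsto (fun k => X (ns k) ω) atTop (𝓝 (WithLp.ofLp (h₀ ω))) := by
    filter_upwards [hns, ae_all_iff.2 fun n => coeFn_toL2 (X n)] with ω h1 h2
    have := ((EuclideanSpace.equiv (Fin d) ℝ).continuous.tendsto _).comp h1
    refine this.congr fun k => ?_
    simp only [Function.comp_apply]
    rw [← hX, h2]
    rfl
  have hbound : ∀ᵐ ω ∂P, ‖WithLp.ofLp (h₀ ω)‖ ≤ r := by
    filter_upwards [hconv, ae_all_iff.2 fun n => ae_norm_le_norm (X n)] with ω h1 h2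
    exact le_of_tendsto' h1.norm fun k => (h2 _).trans (hXr _)
  have hmem : MemLp (fun ω => WithLp.ofLp (h₀ ω)) ∞ P :=
    memLp_top_of_bound ((EuclideanSpace.equiv (Fin d) ℝ).continuous.comp_aestronglyMeasurable
      (Lp.aestronglyMeasurable h₀)) r hbound
  have hcoe := MemLp.coeFn_toLp hmem
  refine ⟨hmem.toLp _, ⟨hC (fun k => X (ns k)) _ ⟨r, fun k => hXr _⟩ ?_ fun k => (hXmem _).1,
    ?_⟩, ?_⟩
  · filter_upwards [hconv, hcoe] with ω h1 h2
    rwa [h2]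
  · rw [mem_closedBall_zero_iff]
    refine norm_le_of_ae_norm_le hr ?_
    filter_upwards [hbound, hcoe] with ω h1 h2
    rwa [h2]
  · refine Lp.ext ?_
    filter_upwards [hcoe, coeFn_toL2 (hmem.toLp _)] with ω h1 h2
    rw [h2, h1]

theorem FatouClosed.exists_density_separating {C : Set (Lp (Fin d → ℝ) ∞ P)} (hC : FatouClosed C)
    (hconv : Convex ℝ C) (h0 : 0 ∉ C) :
    ∃ (U : Lp (Fin d → ℝ) 1 P) (u : ℝ), 0 < u ∧ ∀ X ∈ C, u ≤ ∫ ω, ∑ i, U ω i * X ω i ∂P := by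
  have huniv : FatouClosed (Set.univ : Set (Lp (Fin d → ℝ) ∞ P)) :=
    fun _ _ _ _ _ => Set.mem_univ _
  obtain ⟨f, u, hu, hfC, hf⟩ := exists_separating_functional (J := toL2 d P) toL2_injective
    (fun r => by simpa using huniv.isClosed_image_toL2 r) hconv hC.isClosed_image_toL2 h0
  obtain ⟨U, hU⟩ := exists_density (f := f) fun X hb h => hf X hb (tendsto_toL2 hb h)
  exact ⟨U, u, hu, fun X hX => hU X ▸ hfC X hX⟩

/-- A convex set that is closed under bounded almost sure convergence is weak* closed. -/
theorem FatouClosed.isClosed_weakStar {C : Set (Lp (Fin d → ℝ) ∞ P)} (hC : FatouClosed C)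
    (hconv : Convex ℝ C) : IsClosed[weakStarTopology d P] C := by
  let := weakStarTopology d P
  rw [← isOpen_compl_iff, isOpen_iff_mem_nhds]
  intro X₀ hX₀
  -- Translating `X₀` to the origin makes the separation of `0` applicable; the half-space it yields
  -- is a weak* neighbourhood of `X₀` missing `C`.
  have htrans : FatouClosed ((fun X => X₀ + X) ⁻¹' C) := by
    rintro X Y ⟨M, hM⟩ hlim hX
    refine hC (fun n => X₀ + X n) (X₀ + Y)
      ⟨‖X₀‖ + M, fun n => (norm_add_le _ _).trans (by gcongr; exact hM n)⟩ ?_ hX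
    filter_upwards [hlim, Lp.coeFn_add X₀ Y, ae_all_iff.2 fun n => Lp.coeFn_add X₀ (X n)]
      with ω h1 h2 h3
    simp only [h2, h3, Pi.add_apply]
    exact h1.const_add _
  obtain ⟨U, u, hu, hUC⟩ := htrans.exists_density_separating
    (hconv.translate_preimage_right X₀) (by simpa using hX₀)
  have hcont : Continuous fun X : Lp (Fin d → ℝ) ∞ P => ∫ ω, ∑ i, U ω i * X ω i ∂P :=
    continuous_iInf_dom (i := U) continuous_induced_dom
  have hopen := hcont.tendsto X₀ (Iio_mem_nhds (lt_add_of_pos_right _ hu))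
  filter_upwards [hopen] with X hX hXC
  have h1 := hUC (X - X₀) (by simpa using hXC)
  have h2 : ∫ ω, ∑ i, U ω i * (X - X₀ : Lp (Fin d → ℝ) ∞ P) ω i ∂P =
      ∫ ω, ∑ i, U ω i * X ω i ∂P - ∫ ω, ∑ i, U ω i * X₀ ω i ∂P := by
    rw [← integral_sub (integrable_dualPairing U X) (integrable_dualPairing U X₀)]
    refine integral_congr_ae ?_
    filter_upwards [Lp.coeFn_sub X X₀] with ω hω
    simp only [hω, Pi.sub_apply, mul_sub, Finset.sum_sub_distrib]
  have h3 : ∫ ω, ∑ i, U ω i * X ω i ∂P < ∫ ω, ∑ i, U ω i * X₀ ω i ∂P + u := hX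
  linarith

end WeakStar

/-! ### Aggregation of random vectors -/

section Aggregate

variable {P : Measure Ω} {d : ℕ}

theorem coeFn_aggregate (Λ : AggregationFunction d) (X : Lp (Fin d → ℝ) ∞ P) :
    aggregate Λ X =ᵐ[P] fun ω => Λ (X ω) :=
  MemLp.coeFn_toLp (Λ.memLp X)

theorem aggregate_mono (Λ : AggregationFunction d) {X Z : Lp (Fin d → ℝ) ∞ P} (h : Z ≤ X) :
    aggregate Λ Z ≤ aggregate Λ X := by
  rw [← Lp.coeFn_le] at h ⊢
  filter_upwards [h, coeFn_aggregate Λ X, coeFn_aggregate Λ Z] with ω h1 h2 h3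
  rw [h2, h3]
  exact Λ.increasing _ _ h1

theorem aggregate_concave (Λ : AggregationFunction d) (X Z : Lp (Fin d → ℝ) ∞ P) {γ : ℝ}
    (h0 : 0 ≤ γ) (h1 : γ ≤ 1) :
    γ • aggregate Λ X + (1 - γ) • aggregate Λ Z ≤ aggregate Λ (γ • X + (1 - γ) • Z) := by
  rw [← Lp.coeFn_le]
  filter_upwards [coeFn_aggregate Λ X, coeFn_aggregate Λ Z,
    coeFn_aggregate Λ (γ • X + (1 - γ) • Z), Lp.coeFn_add (γ • X) ((1 - γ) • Z),
    Lp.coeFn_add (γ • aggregate Λ X) ((1 - γ) • aggregate Λ Z), Lp.coeFn_smul γ X,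
    Lp.coeFn_smul (1 - γ) Z, Lp.coeFn_smul γ (aggregate Λ X),
    Lp.coeFn_smul (1 - γ) (aggregate Λ Z)] with ω a1 a2 a3 a4 a5 a6 a7 a8 a9
  simp only [a3, a4, a5, a6, a7, a8, a9, Pi.add_apply, Pi.smul_apply, a1, a2, smul_eq_mul]
  exact Λ.concave _ _ γ h0 h1

variable [IsProbabilityMeasure P]

theorem aggregate_const (Λ : AggregationFunction d) (z : Fin d → ℝ) :
    aggregate Λ (Lp.const ∞ P z) = Lp.const ∞ P (Λ z) := by
  refine Lp.ext ?_
  filter_upwards [coeFn_aggregate Λ (Lp.const ∞ P z), Lp.coeFn_const ∞ P z,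
    Lp.coeFn_const ∞ P (Λ z)] with ω h1 h2 h3
  rw [h1, h2, h3]
  rfl

theorem norm_aggregate_le (Λ : AggregationFunction d) {X : Lp (Fin d → ℝ) ∞ P} {M : ℝ}
    (hX : ‖X‖ ≤ M) : ‖aggregate Λ X‖ ≤ max |Λ fun _ => -M| |Λ fun _ => M| := by
  refine norm_le_of_ae_norm_le (le_max_of_le_left (abs_nonneg _)) ?_
  filter_upwards [coeFn_aggregate Λ X, ae_norm_le_norm X] with ω h1 h2
  have hi : ∀ i, |X ω i| ≤ M := fun i => (norm_le_pi_norm (X ω) i).trans (h2.trans hX)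
  rw [h1, Real.norm_eq_abs]
  exact abs_le_max_abs_abs (Λ.increasing _ _ fun i => (abs_le.mp (hi i)).1)
    (Λ.increasing _ _ fun i => (abs_le.mp (hi i)).2)

end Aggregate

/-! ### Acceptance sets and the Fatou property -/

section RiskMeasure

variable {P : Measure Ω} {d : ℕ}

variable [IsProbabilityMeasure P]

theorem const_smul_eq {F : Type*} [NormedAddCommGroup F] [NormedSpace ℝ F] (c : ℝ) (z : F) :
    Lp.const ∞ P (c • z) = c • Lp.const ∞ P z :=
  (Lp.constₗ ∞ P ℝ).map_smul c z

theorem ConvexMonetaryRiskMeasure.apply_const (ρ : ConvexMonetaryRiskMeasure P) (c : ℝ) :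
    ρ (Lp.const ∞ P c) = ρ 0 - c := by
  simpa using ρ.translative 0 c

theorem ConvexMonetaryRiskMeasure.le_of_tendsto (ρ : ConvexMonetaryRiskMeasure P) {a : ℝ}
    {Y : ℕ → Lp ℝ ∞ P} {Y₀ : Lp ℝ ∞ P} (hb : ∃ C : ℝ, ∀ n, ‖Y n‖ ≤ C)
    (hlim : ∀ᵐ ω ∂P, Tendsto (fun n => Y n ω) atTop (𝓝 (Y₀ ω))) (ha : ∀ n, ρ (Y n) ≤ a) :
    ρ Y₀ ≤ a := by
  refine (ρ.fatou Y Y₀ hb hlim).trans ?_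
  obtain ⟨C, hC⟩ := hb
  have hbelow : ∀ n, ρ (Lp.const ∞ P C) ≤ ρ (Y n) := by
    refine fun n => ρ.monotone _ _ ?_
    rw [← Lp.coeFn_le]
    filter_upwards [ae_norm_le_norm (Y n), Lp.coeFn_const ∞ P C] with ω h1 h2
    rw [h2]
    exact (le_abs_self _).trans (h1.trans (hC n))
  exact liminf_le_of_le (isBoundedUnder_of ⟨_, hbelow⟩) fun b hb => by
    obtain ⟨n, hn⟩ := hb.exists
    exact hn.trans (ha n)

theorem acceptance_mono (ρ : ConvexMonetaryRiskMeasure P) {Y Z : Lp ℝ ∞ P} (h : Z ≤ Y)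
    (hZ : Z ∈ acceptanceSet ρ) : Y ∈ acceptanceSet ρ :=
  (ρ.monotone Y Z h).trans hZ

theorem acceptance_convex (ρ : ConvexMonetaryRiskMeasure P) {Y Z : Lp ℝ ∞ P} {γ : ℝ}
    (h0 : 0 ≤ γ) (h1 : γ ≤ 1) (hY : Y ∈ acceptanceSet ρ) (hZ : Z ∈ acceptanceSet ρ) :
    γ • Y + (1 - γ) • Z ∈ acceptanceSet ρ := by
  refine (ρ.convex Y Z γ h0 h1).trans ?_
  have hY' : ρ Y ≤ 0 := hY
  have hZ' : ρ Z ≤ 0 := hZ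
  nlinarith [mul_nonneg_of_nonpos_of_nonpos hY' hZ']

/-- Two shifts, inside and outside `Λ`, cover both measures: `z = 0` gives `Rins` and `c = 0` gives
`Rsen`. -/
theorem fatouClosed_aggregate (Λ : AggregationFunction d) (ρ : ConvexMonetaryRiskMeasure P)
    (z : Fin d → ℝ) (c : ℝ) : FatouClosed {X : Lp (Fin d → ℝ) ∞ P |
      aggregate Λ (X + Lp.const ∞ P z) + Lp.const ∞ P c ∈ acceptanceSet ρ} := by
  rintro X Y ⟨M, hM⟩ hlim hX
  refine ρ.le_of_tendsto ⟨_, fun n => (norm_add_le _ _).trans (add_le_add_left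
    (norm_aggregate_le Λ ((norm_add_le _ _).trans (add_le_add_left (hM n) _))) _)⟩ ?_ hX
  have hcoe : ∀ X : Lp (Fin d → ℝ) ∞ P, ∀ᵐ ω ∂P,
      (aggregate Λ (X + Lp.const ∞ P z) + Lp.const ∞ P c : Lp ℝ ∞ P) ω = Λ (X ω + z) + c := by
    intro X
    filter_upwards [Lp.coeFn_add (aggregate Λ (X + Lp.const ∞ P z)) (Lp.const ∞ P c),
      coeFn_aggregate Λ (X + Lp.const ∞ P z), Lp.coeFn_add X (Lp.const ∞ P z),
      Lp.coeFn_const ∞ P z, Lp.coeFn_const ∞ P c] with ω h1 h2 h3 h4 h5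
    simp only [h1, Pi.add_apply, h2, h3, h4, h5, Function.const_apply]
  filter_upwards [hlim, hcoe Y, ae_all_iff.2 fun n => hcoe (X n)] with ω h1 h2 h3
  simp only [h2, h3]
  exact ((Λ.continuous.tendsto _).comp (h1.add_const z)).add_const c

end RiskMeasure

/-! ### The properties of `Rins` and `Rsen` -/

section Properties

variable {P : Measure Ω} {d : ℕ}

theorem IsConvex.convex_setOf_mem {R : Lp (Fin d → ℝ) ∞ P → Set (Fin d → ℝ)} (hR : IsConvex R)
    (z : Fin d → ℝ) : Convex ℝ {X | z ∈ R X} := by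
  intro X hX Z hZ a b ha hb hab
  obtain rfl : b = 1 - a := by linarith
  refine hR X Z a ha (by linarith) ⟨a • z, ⟨z, hX, rfl⟩, (1 - a) • z, ⟨z, hZ, rfl⟩, ?_⟩
  change a • z + (1 - a) • z = z
  rw [← add_smul, hab, one_smul]

variable [IsProbabilityMeasure P]

variable (Λ : AggregationFunction d) (ρ : ConvexMonetaryRiskMeasure P)

theorem isMonotone_Rins : IsMonotone (Rins Λ ρ) := fun _ _ h _ hz =>
  acceptance_mono ρ (by gcongr; exact aggregate_mono Λ h) hz

theorem isMonotone_Rsen : IsMonotone (Rsen Λ ρ) := fun _ _ h _ hz =>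
  acceptance_mono ρ (aggregate_mono Λ (by gcongr)) hz

theorem isConvex_Rins : IsConvex (Rins Λ ρ) := by
  rintro X Z γ h0 h1 _ ⟨_, ⟨x, hx, rfl⟩, _, ⟨z, hz, rfl⟩, rfl⟩
  refine acceptance_mono ρ ?_ (acceptance_convex ρ h0 h1 hx hz)
  have hsum : ∑ i, (γ • x + (1 - γ) • z) i = γ • ∑ i, x i + (1 - γ) • ∑ i, z i := by
    simp [Finset.sum_add_distrib, Finset.mul_sum]
  change _ ≤ _ + Lp.const ∞ P (∑ i, (γ • x + (1 - γ) • z) i)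
  rw [hsum, map_add, const_smul_eq, const_smul_eq, smul_add, smul_add, add_add_add_comm]
  gcongr
  exact aggregate_concave Λ X Z h0 h1

theorem isConvex_Rsen : IsConvex (Rsen Λ ρ) := by
  rintro X Z γ h0 h1 _ ⟨_, ⟨x, hx, rfl⟩, _, ⟨z, hz, rfl⟩, rfl⟩
  refine acceptance_mono ρ ?_ (acceptance_convex ρ h0 h1 hx hz)
  change _ ≤ aggregate Λ (_ + Lp.const ∞ P (γ • x + (1 - γ) • z))
  rw [map_add, const_smul_eq, const_smul_eq, add_add_add_comm, ← smul_add, ← smul_add]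
  exact aggregate_concave Λ _ _ h0 h1

theorem isWeakStarClosed_Rins : IsWeakStarClosed (Rins Λ ρ) := by
  intro z
  refine FatouClosed.isClosed_weakStar ?_ ((isConvex_Rins Λ ρ).convex_setOf_mem z)
  simpa [Rins] using fatouClosed_aggregate Λ ρ 0 (∑ i, z i)

theorem isWeakStarClosed_Rsen : IsWeakStarClosed (Rsen Λ ρ) := by
  intro z
  refine FatouClosed.isClosed_weakStar ?_ ((isConvex_Rsen Λ ρ).convex_setOf_mem z)
  simpa [Rsen] using fatouClosed_aggregate Λ ρ z 0

theorem mem_Rins_const_iff (x z : Fin d → ℝ) :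
    z ∈ Rins Λ ρ (Lp.const ∞ P x) ↔ ρ 0 ≤ Λ x + ∑ i, z i := by
  change ρ (aggregate Λ (Lp.const ∞ P x) + Lp.const ∞ P (∑ i, z i)) ≤ 0 ↔ _
  rw [aggregate_const, ρ.translative, ρ.apply_const, sub_sub, sub_nonpos]

theorem mem_Rsen_zero_iff (z : Fin d → ℝ) : z ∈ Rsen Λ ρ 0 ↔ ρ 0 ≤ Λ z := by
  change ρ (aggregate Λ (0 + Lp.const ∞ P z)) ≤ 0 ↔ _
  rw [zero_add, aggregate_const, ρ.apply_const, sub_nonpos]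

theorem isFiniteAtZero_Rins (hd : 0 < d) : IsFiniteAtZero (Rins Λ ρ) := by
  have hiff := mem_Rins_const_iff Λ ρ 0
  rw [map_zero] at hiff
  have hsum : ∀ c : ℝ, ∑ i, (Pi.single ⟨0, hd⟩ c : Fin d → ℝ) i = c := fun c => by simp
  constructor
  · refine Set.Nonempty.ne_empty ⟨Pi.single ⟨0, hd⟩ (ρ 0 - Λ 0), (hiff _).2 ?_⟩
    rw [hsum]
    linarith
  · intro h
    have := (hiff (Pi.single ⟨0, hd⟩ (ρ 0 - Λ 0 - 1))).1 (h ▸ Set.mem_univ _)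
    rw [hsum] at this
    linarith

theorem isFiniteAtZero_Rsen (h : ρ 0 ∈ interior (Set.range Λ)) : IsFiniteAtZero (Rsen Λ ρ) := by
  constructor
  · obtain ⟨z, hz⟩ := interior_subset h
    exact Set.Nonempty.ne_empty ⟨z, (mem_Rsen_zero_iff Λ ρ z).2 hz.ge⟩
  · intro huniv
    -- Interiority of `ρ 0` supplies a value of `Λ` strictly below it, hence an unacceptable `z`.
    obtain ⟨_, ⟨z, rfl⟩, hz⟩ : ∃ y ∈ Set.range Λ, y < ρ 0 :=
      ((eventually_nhdsWithin_of_eventually_nhds (s := Set.Iio (ρ 0))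
        (mem_interior_iff_mem_nhds.1 h)).and self_mem_nhdsWithin).exists
    exact hz.not_ge ((mem_Rsen_zero_iff Λ ρ z).1 (huniv ▸ Set.mem_univ z))

theorem isTranslative_Rsen : IsTranslative (Rsen Λ ρ) := by
  intro X z
  ext y
  rw [Set.mem_image]
  constructor
  · intro hy
    refine ⟨y + z, ?_, add_sub_cancel_right y z⟩
    change aggregate Λ (X + Lp.const ∞ P (y + z)) ∈ acceptanceSet ρ
    rw [add_comm y, map_add, ← add_assoc]
    exact hy
  · rintro ⟨x, hx, rfl⟩
    change aggregate Λ (X + Lp.const ∞ P z + Lp.const ∞ P (x - z)) ∈ acceptanceSet ρ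
    rw [add_assoc, ← map_add, add_sub_cancel]
    exact hx

end Properties

/-! ### Failure of translativity for `Rins` -/

section Counterexample

variable {P : Measure Ω} {d : ℕ}

/-- Twice the total. -/
def doubleSum (d : ℕ) (hd : 0 < d) : AggregationFunction d where
  toFun x := 2 * ∑ i, x i
  increasing x z h := by
    have := Finset.sum_le_sum fun i (_ : i ∈ Finset.univ) => h i
    linarith
  concave x z γ _ _ := by
    simp only [Pi.add_apply, Pi.smul_apply, smul_eq_mul, Finset.sum_add_distrib, ← Finset.mul_sum]
    linarith
  nonconstant := ⟨0, fun _ => 1, by simp [hd.ne']⟩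

theorem range_doubleSum (hd : 0 < d) : Set.range (doubleSum d hd) = Set.univ := by
  refine Set.eq_univ_of_forall fun y => ⟨Pi.single ⟨0, hd⟩ (y / 2), ?_⟩
  simp only [doubleSum, Finset.sum_pi_single', Finset.mem_univ, if_true]
  ring

theorem integrable_coeFn_top [IsProbabilityMeasure P] (Y : Lp ℝ ∞ P) : Integrable Y P :=
  (Lp.memLp Y).integrable le_top

/-- The risk measure `Y ↦ -E[Y]`. -/
noncomputable def negExpectation (P : Measure Ω) [IsProbabilityMeasure P] :
    ConvexMonetaryRiskMeasure P where
  toFun Y := -∫ ω, Y ω ∂P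
  monotone Y₁ Y₂ h := neg_le_neg
    (integral_mono_ae (integrable_coeFn_top Y₂) (integrable_coeFn_top Y₁) ((Lp.coeFn_le _ _).2 h))
  translative Y y := by
    rw [integral_congr_ae (Lp.coeFn_add Y (Lp.const ∞ P y)),
      integral_add' (integrable_coeFn_top _) (integrable_coeFn_top _),
      integral_congr_ae (Lp.coeFn_const ∞ P y)]
    simp [sub_eq_add_neg, add_comm]
  convex Y₁ Y₂ γ _ _ := by
    rw [integral_congr_ae (Lp.coeFn_add (γ • Y₁) ((1 - γ) • Y₂)),
      integral_add' (integrable_coeFn_top _) (integrable_coeFn_top _),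
      integral_congr_ae (Lp.coeFn_smul γ Y₁), integral_congr_ae (Lp.coeFn_smul (1 - γ) Y₂)]
    simp only [Pi.smul_apply, smul_eq_mul, integral_const_mul]
    linarith
  fatou Y Y₀ hb hlim := by
    obtain ⟨C, hC⟩ := hb
    refine (Tendsto.liminf_eq (Tendsto.neg ?_)).ge
    refine tendsto_integral_of_dominated_convergence (fun _ => C)
      (fun n => Lp.aestronglyMeasurable (Y n)) (integrable_const _) (fun n => ?_) hlim
    filter_upwards [ae_norm_le_norm (Y n)] with ω h using h.trans (hC n)

theorem not_isTranslative_Rins_doubleSum [IsProbabilityMeasure P] (hd : 0 < d) :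
    ¬ IsTranslative (Rins (doubleSum d hd) (negExpectation P)) := by
  intro h
  set x : Fin d → ℝ := Pi.single ⟨0, hd⟩ 1 with hx
  have hsum : ∑ i, x i = 1 := by simp [hx]
  have hρ : negExpectation P 0 = 0 := by
    change -∫ ω, (0 : Lp ℝ ∞ P) ω ∂P = 0
    rw [integral_congr_ae (Lp.coeFn_zero ℝ ∞ P)]
    simp
  -- Shifting the position by `x` lowers the required total by `2`, whereas translativity allows
  -- only `1`: it would put `-x` in `Rins` at `0`, where the total must be nonnegative.
  have hmem : (-(2 : ℝ) • x) ∈ Rins (doubleSum d hd) (negExpectation P) (0 + Lp.const ∞ P x) := by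
    rw [zero_add, mem_Rins_const_iff, hρ]
    simp [doubleSum, ← Finset.mul_sum, hsum]
  rw [h] at hmem
  obtain ⟨y, hy, hyx⟩ := hmem
  rw [← map_zero (Lp.const ∞ P), mem_Rins_const_iff, hρ] at hy
  obtain rfl : y = -x := by
    have : y = -(2 : ℝ) • x + x := sub_eq_iff_eq_add.1 hyx
    rw [this]
    module
  simp [doubleSum, hsum] at hy
  linarith

end Counterexample

end SystemicRisk

theorem proposition2p5 {Ω : Type*} [MeasurableSpace Ω] (P : Measure Ω) [IsProbabilityMeasure P]
    (d : ℕ) (hd : 0 < d) :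
    (∀ (Λ : SystemicRisk.AggregationFunction d) (ρ : SystemicRisk.ConvexMonetaryRiskMeasure P),
      ρ 0 ∈ interior (Set.range Λ) →
        (SystemicRisk.IsMonotone (SystemicRisk.Rins Λ ρ) ∧
          SystemicRisk.IsConvex (SystemicRisk.Rins Λ ρ) ∧
          SystemicRisk.IsWeakStarClosed (SystemicRisk.Rins Λ ρ) ∧
          SystemicRisk.IsFiniteAtZero (SystemicRisk.Rins Λ ρ)) ∧
        (SystemicRisk.IsMonotone (SystemicRisk.Rsen Λ ρ) ∧
          SystemicRisk.IsConvex (SystemicRisk.Rsen Λ ρ) ∧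
          SystemicRisk.IsWeakStarClosed (SystemicRisk.Rsen Λ ρ) ∧
          SystemicRisk.IsFiniteAtZero (SystemicRisk.Rsen Λ ρ) ∧
          SystemicRisk.IsTranslative (SystemicRisk.Rsen Λ ρ))) ∧
    (∃ (Λ : SystemicRisk.AggregationFunction d) (ρ : SystemicRisk.ConvexMonetaryRiskMeasure P),
      ρ 0 ∈ interior (Set.range Λ) ∧
        ¬ SystemicRisk.IsTranslative (SystemicRisk.Rins Λ ρ)) := by
  open SystemicRisk in
  refine ⟨fun Λ ρ h => ⟨⟨isMonotone_Rins Λ ρ, isConvex_Rins Λ ρ, isWeakStarClosed_Rins Λ ρ,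
    isFiniteAtZero_Rins Λ ρ hd⟩, isMonotone_Rsen Λ ρ, isConvex_Rsen Λ ρ,
    isWeakStarClosed_Rsen Λ ρ, isFiniteAtZero_Rsen Λ ρ h, isTranslative_Rsen Λ ρ⟩,
    doubleSum d hd, negExpectation P, ?_, not_isTranslative_Rins_doubleSum hd⟩
  rw [SystemicRisk.range_doubleSum, interior_univ]
  exact Set.mem_univ _
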